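/- **Theorem (Hirota equation).** Let $\mathbb K,K\in\{\mathbb R,\mathbb C\}$ with $\mathbb K\subseteq K$, let $n\ge 0$, and let $f^0,\dots,f^n$ and $\bar f^0,\dots,\bar f^n$ be two independent families of functions $\mathbb K\to K$ that are infinitely differentiable (over $\mathbb K$; thus analytic when $\mathbb K=\mathbb C$) at the points $z$ and $\bar z$ of $\mathbb K$ respectively. Here $\bar z$ may be any point, in particular the complex conjugate of $z$. Write $f^{(s)A}(z)$, $\bar f^{(s)A}(\bar z)$ for the $s$-th derivatives. Let $F$ be the fermionic Fock space over $K$ with modes $\psi_s,\psi_s^+$, $s=0,1,2,\dots$, satisfying $[\psi_s,\psi_t]_+=[\psi^+_s,\psi^+_t]_+=0$, $[\psi_s,\psi_t^+]_+=\delta_{s,t}$, with no-particle vacuum $\psi_s|\emptyset\rangle=0$, $\langle\emptyset|\psi_s^+=0$, $\langle\emptyset|\emptyset\rangle=1$; it has the basis of states $|u\rangle=\psi^+_{u_1}\cdots\psi^+_{u_k}|\emptyset\rangle$, $u=\{u_1<\dots<u_k\}$ a finite set of modes. Let $\widehat F\supseteq F$ be the space of arbitrary formal linear combinations of the $|u\rangle$,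 and $F\,\widehat\otimes\, F$ the space of formal linear combinations of the $|u\rangle\otimes|v\rangle$. Put $$\psi_{f^A}(z)=\sum_{s\ge 0} f^{(s)A}(z)\,\psi_s,\qquad \psi^+_{\bar f^{A}}(\bar z)=\sum_{s\ge 0}\bar f^{(s)A}(\bar z)\,\psi_s^+ ,$$ acting on $F$ and on $\widehat F$ respectively, and define the embedding operator $\mathcal G=\mathcal G(z,\bar z):F\to\widehat F$ by $$\mathcal G=\sum_{a=0}^{n+1}\ \sum_{0\le A_1<\dots<A_a\le n}\psi^+_{\bar f^{A_1}}(\bar z)\cdots\psi^+_{\bar f^{A_a}}(\bar z)\,|\emptyset\rangle\langle\emptyset|\,\psi_{f^{A_a}}(z)\cdots\psi_{f^{A_1}}(z).$$ Then $$\sum_{s=0}^\infty \psi_s^+\mathcal G\otimes\psi_s\mathcal G=\sum_{s=0}^\infty \mathcal G\psi_s^+\otimes\mathcal G\psi_s$$ as maps $F\otimes F\to F\,\widehat\otimes\,F$. Here, on both sides, when the series is applied to a vector of $F\otimes F$, only finitely many terms contribute to the coefficient of each $|u\rangle\otimes|v\rangle$. -/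

import Mathlib

open scoped TensorProduct ContDiff

noncomputable section

namespace ChiralFermion

/-- The fermionic Fock space with modes `0, 1, 2, …`: finite linear combinations of the occupation
states `|u⟩ = ψ⁺_{u₁} ψ⁺_{u₂} ⋯ |∅⟩`, where `u = {u₁ < u₂ < ⋯}` is a finite set of modes. -/
abbrev Fock (K : Type*) [Zero K] : Type _ := Finset ℕ →₀ K

/-- The completed Fock space: arbitrary formal linear combinations `∑ u, w u |u⟩`. -/
abbrev FormalFock (K : Type*) : Type _ := Finset ℕ → K

/-- The completed tensor square of the Fock space: formal linear combinations of `|u⟩ ⊗ |v⟩`. -/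
abbrev FormalFock₂ (K : Type*) : Type _ := Finset ℕ × Finset ℕ → K

section Basic

variable {K : Type*} [CommRing K]

/-- The sign `(-1)^{#{t ∈ u : t < s}}`. -/
def modeSign (K : Type*) [CommRing K] (s : ℕ) (u : Finset ℕ) : K :=
  (-1) ^ (u.filter (· < s)).card

/-- `ψ⁺_s` on the Fock space: `ψ⁺_s |u⟩ = ± |u ∪ {s}⟩` if `s ∉ u`, and `0` otherwise. -/
def creation (K : Type*) [CommRing K] (s : ℕ) : Fock K →ₗ[K] Fock K :=
  Finsupp.linearCombination K fun u : Finset ℕ =>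
    if s ∈ u then (0 : Fock K) else Finsupp.single (insert s u) (modeSign K s u)

/-- `ψ_s` on the Fock space: `ψ_s |u⟩ = ± |u \ {s}⟩` if `s ∈ u`, and `0` otherwise. -/
def annihilation (K : Type*) [CommRing K] (s : ℕ) : Fock K →ₗ[K] Fock K :=
  Finsupp.linearCombination K fun u : Finset ℕ =>
    if s ∈ u then Finsupp.single (u.erase s) (modeSign K s u) else (0 : Fock K)

/-- `ψ⁺_s` on formal combinations: the coefficient of `|u⟩` in `ψ⁺_s w`. -/
def formalCreation (K : Type*) [CommRing K] (s : ℕ) : FormalFock K →ₗ[K] FormalFock K where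
  toFun w u := if s ∈ u then modeSign K s u * w (u.erase s) else 0
  map_add' w w' := by ext u; by_cases h : s ∈ u <;> simp [h, mul_add]
  map_smul' c w := by ext u; by_cases h : s ∈ u <;> simp [h, mul_left_comm]

/-- `ψ_s` on formal combinations: the coefficient of `|u⟩` in `ψ_s w`. -/
def formalAnnihilation (K : Type*) [CommRing K] (s : ℕ) : FormalFock K →ₗ[K] FormalFock K where
  toFun w u := if s ∈ u then 0 else modeSign K s u * w (insert s u)
  map_add' w w' := by ext u; by_cases h : s ∈ u <;> simp [h, mul_add]
  map_smul' c w := by ext u; by_cases h : s ∈ u <;> simp [h, mul_left_comm]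

lemma modeSign_erase_self (s : ℕ) (u : Finset ℕ) : modeSign K s (u.erase s) = modeSign K s u := by
  unfold modeSign
  congr 2
  ext x; simp only [Finset.mem_filter, Finset.mem_erase]; grind

lemma modeSign_insert_self (s : ℕ) (u : Finset ℕ) : modeSign K s (insert s u) = modeSign K s u := by
  unfold modeSign
  congr 2
  ext x; simp only [Finset.mem_filter, Finset.mem_insert]; grind

lemma modeSign_insert (s t : ℕ) (u : Finset ℕ) (h : t ∉ u) :
    modeSign K s (insert t u) = if t < s then -modeSign K s u else modeSign K s u := by
  unfold modeSign
  rw [Finset.filter_insert]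
  split_ifs
  · rw [Finset.card_insert_of_notMem (by simp [h]), pow_succ]; ring
  · rfl

lemma modeSign_erase (s t : ℕ) (u : Finset ℕ) (h : t ∈ u) :
    modeSign K s (u.erase t) = if t < s then -modeSign K s u else modeSign K s u := by
  have := modeSign_insert (K := K) s t (u.erase t) (by simp)
  rw [Finset.insert_erase h] at this
  rw [this]; split_ifs <;> simp

lemma modeSign_mul_self (s : ℕ) (u : Finset ℕ) : modeSign K s u * modeSign K s u = 1 := by
  unfold modeSign; rw [← mul_pow]; simp

/-- The two actions of `ψ⁺_s` agree on finite linear combinations. -/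
theorem coe_creation (s : ℕ) (v : Fock K) :
    (⇑(creation K s v) : FormalFock K) = formalCreation K s ⇑v := by
  induction v using Finsupp.induction_linear with
  | zero => simp
  | add v w hv hw => rw [map_add, Finsupp.coe_add, Finsupp.coe_add, map_add, hv, hw]
  | single x c =>
    ext u
    by_cases hx : s ∈ x
    · have : s ∈ u → x ≠ u.erase s := by rintro - rfl; simp at hx
      by_cases hu : s ∈ u <;>
        simp_all [creation, formalCreation]
    · by_cases hu : s ∈ u
      · by_cases h : x = u.erase s
        · subst h
          simp [creation, formalCreation, hu, modeSign_erase_self, mul_comm]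
        · have h' : insert s x ≠ u := by rintro rfl; simp [hx] at h
          simp [creation, formalCreation, hu, hx, h, h']
      · have h' : insert s x ≠ u := by rintro rfl; simp at hu
        simp [creation, formalCreation, hu, hx, h']

/-- The two actions of `ψ_s` agree on finite linear combinations. -/
theorem coe_annihilation (s : ℕ) (v : Fock K) :
    (⇑(annihilation K s v) : FormalFock K) = formalAnnihilation K s ⇑v := by
  induction v using Finsupp.induction_linear with
  | zero => simp
  | add v w hv hw => rw [map_add, Finsupp.coe_add, Finsupp.coe_add, map_add, hv, hw]
  | single x c =>
    ext u
    by_cases hx : s ∈ x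
    · by_cases hu : s ∈ u
      · have h' : x.erase s ≠ u := by rintro rfl; simp at hu
        simp [annihilation, formalAnnihilation, hu, hx, h']
      · by_cases h : x = insert s u
        · subst h
          simp [annihilation, formalAnnihilation, hu, modeSign_insert_self, mul_comm]
        · have h' : x.erase s ≠ u := by rintro rfl; simp [hx] at h
          simp [annihilation, formalAnnihilation, hu, hx, h, h']
    · have : x ≠ insert s u := by rintro rfl; simp at hx
      by_cases hu : s ∈ u <;>
        simp [annihilation, formalAnnihilation, hu, hx, this]

/-- The canonical anticommutation relations. -/
theorem formalCreation_anticomm (s t : ℕ) (w : FormalFock K) :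
    formalCreation K s (formalCreation K t w) + formalCreation K t (formalCreation K s w) = 0 := by
  ext u
  simp only [formalCreation, LinearMap.coe_mk, AddHom.coe_mk, Pi.add_apply, Pi.zero_apply,
    Finset.mem_erase]
  by_cases hst : s = t
  · simp [hst]
  by_cases hs : s ∈ u <;> by_cases ht : t ∈ u <;>
    simp [hs, ht, hst, Ne.symm hst, modeSign_erase]
  rw [Finset.erase_right_comm]
  rcases lt_or_gt_of_ne hst with h | h <;> simp [h, h.not_gt] <;> ring

theorem formalAnnihilation_anticomm (s t : ℕ) (w : FormalFock K) :
    formalAnnihilation K s (formalAnnihilation K t w) +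
      formalAnnihilation K t (formalAnnihilation K s w) = 0 := by
  ext u
  simp only [formalAnnihilation, LinearMap.coe_mk, AddHom.coe_mk, Pi.add_apply, Pi.zero_apply,
    Finset.mem_insert]
  by_cases hst : s = t
  · simp [hst]
  by_cases hs : s ∈ u <;> by_cases ht : t ∈ u <;>
    simp [hs, ht, hst, Ne.symm hst, modeSign_insert]
  rw [Finset.insert_comm]
  rcases lt_or_gt_of_ne hst with h | h <;> simp [h, h.not_gt] <;> ring

theorem formalAnnihilation_formalCreation (s t : ℕ) (w : FormalFock K) :
    formalAnnihilation K s (formalCreation K t w) + formalCreation K t (formalAnnihilation K s w) =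
      if s = t then w else 0 := by
  ext u
  by_cases hst : s = t
  · subst hst
    by_cases hs : s ∈ u <;>
      simp [formalAnnihilation, formalCreation, hs, modeSign_insert_self, modeSign_erase_self,
        ← mul_assoc, modeSign_mul_self]
  · have e : (insert s u).erase t = insert s (u.erase t) := by
      rw [Finset.erase_insert_of_ne hst]
    by_cases hs : s ∈ u <;> by_cases ht : t ∈ u <;>
      simp [formalAnnihilation, formalCreation, hs, ht, hst, Ne.symm hst, modeSign_erase,
        modeSign_insert, e]
    rcases lt_or_gt_of_ne hst with h | h <;> simp [h, h.not_gt] <;> ring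

lemma annihilation_support_finite (v : Fock K) :
    (Function.support fun s => annihilation K s v).Finite := by
  refine (v.support.biUnion id).finite_toSet.subset fun s hs => ?_
  by_contra hc
  refine hs ?_
  simp only [annihilation, Finsupp.linearCombination_apply]
  refine Finset.sum_eq_zero fun u hu => ?_
  have : s ∉ u := fun h => hc (by simpa using ⟨u, by simpa using hu, h⟩)
  simp [this]

lemma formalCreation_support_finite (w : FormalFock K) (u : Finset ℕ) :
    (Function.support fun s => formalCreation K s w u).Finite := by
  refine u.finite_toSet.subset fun s hs => ?_
  by_contra hc
  exact hs (by simp_all [formalCreation])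

/-- The operator `ψ_c = ∑ s, c s ψ_s`; on every vector of the Fock space only finitely many terms
are nonzero. -/
def annihilationField (c : ℕ → K) : Fock K →ₗ[K] Fock K where
  toFun v := ∑ᶠ s, c s • annihilation K s v
  map_add' v w := by
    have h (v : Fock K) : (Function.support fun s => c s • annihilation K s v).Finite :=
      (annihilation_support_finite v).subset fun s hs h => hs (by simp [h])
    rw [← finsum_add_distrib (h v) (h w)]
    simp
  map_smul' a v := by
    have h (v : Fock K) : (Function.support fun s => c s • annihilation K s v).Finite :=
      (annihilation_support_finite v).subset fun s hs h => hs (by simp [h])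
    simp only [map_smul, RingHom.id_apply]
    rw [smul_finsum' _ (h v)]
    exact finsum_congr fun s => smul_comm _ _ _

/-- The operator `ψ⁺_c = ∑ s, c s ψ⁺_s`; in the coefficient of each `|u⟩` only finitely many terms
are nonzero. -/
def creationField (c : ℕ → K) : FormalFock K →ₗ[K] FormalFock K where
  toFun w u := ∑ᶠ s, c s * formalCreation K s w u
  map_add' v w := by
    have h (w : FormalFock K) (u) : (Function.support fun s => c s * formalCreation K s w u).Finite :=
      (formalCreation_support_finite w u).subset fun s hs h => hs (by simp [h])
    ext u
    rw [Pi.add_apply, ← finsum_add_distrib (h v u) (h w u)]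
    simp [mul_add]
  map_smul' a w := by
    have h (u) : (Function.support fun s => c s * formalCreation K s w u).Finite :=
      (formalCreation_support_finite w u).subset fun s hs h => hs (by simp [h])
    ext u
    simp only [map_smul, RingHom.id_apply, Pi.smul_apply, smul_eq_mul]
    rw [← smul_eq_mul, smul_finsum' _ (h u)]
    exact finsum_congr fun s => by simp [mul_left_comm]

/-- The ket `|∅⟩`. -/
def vacuumKet (K : Type*) [CommRing K] : FormalFock K := Pi.single ∅ 1

/-- The bra `⟨∅|`. -/
def vacuumBra (K : Type*) [CommRing K] : Fock K →ₗ[K] K := Finsupp.lapply ∅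

/-- `ψ⁺_{c A₁} ⋯ ψ⁺_{c A_a} |∅⟩` for `S = {A₁ < ⋯ < A_a}`. -/
def embeddingKet {n : ℕ} (c : Fin (n + 1) → ℕ → K) (S : Finset (Fin (n + 1))) : FormalFock K :=
  (((S.sort (· ≤ ·)).map fun A => creationField (c A)).prod :
    Module.End K (FormalFock K)) (vacuumKet K)

/-- `⟨∅| ψ_{c A_a} ⋯ ψ_{c A₁}` for `S = {A₁ < ⋯ < A_a}`. -/
def embeddingBra {n : ℕ} (c : Fin (n + 1) → ℕ → K) (S : Finset (Fin (n + 1))) : Fock K →ₗ[K] K :=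
  vacuumBra K ∘ₗ
    (((S.sort (· ≤ ·)).reverse.map fun A => annihilationField (c A)).prod :
      Module.End K (Fock K))

/-- The embedding operator with coefficient sequences `c A = (f^{(s)A})_s` and
`cbar A = (f̄^{(s)A})_s`, `A = 0, …, n`:
`∑_{a=0}^{n+1} ∑_{A₁<⋯<A_a} ψ⁺_{f̄ A₁} ⋯ ψ⁺_{f̄ A_a} |∅⟩⟨∅| ψ_{f A_a} ⋯ ψ_{f A₁}`. -/
def embeddingOperatorOfCoeff {n : ℕ} (c cbar : Fin (n + 1) → ℕ → K) : Fock K →ₗ[K] FormalFock K :=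
  ∑ a ∈ Finset.range (n + 2), ∑ S ∈ Finset.powersetCard a (Finset.univ : Finset (Fin (n + 1))),
    (embeddingBra c S).smulRight (embeddingKet cbar S)

/-- The canonical map from the tensor square of the completed Fock space to its completion. -/
def toFormalFock₂ (K : Type*) [CommRing K] : FormalFock K ⊗[K] FormalFock K →ₗ[K] FormalFock₂ K :=
  TensorProduct.lift <| LinearMap.mk₂ K (fun w w' p => w p.1 * w' p.2)
    (fun w₁ w₂ w' => by ext p; simp [add_mul])
    (fun a w w' => by ext p; simp [mul_assoc])
    (fun w w₁ w₂ => by ext p; simp [mul_add])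
    (fun a w w' => by ext p; simp [mul_left_comm])

/-- The tensor product of two operators, `(X ⊗ Y)(v ⊗ v') = X v ⊗ Y v'`. -/
def tensorOp (X Y : Fock K →ₗ[K] FormalFock K) : Fock K ⊗[K] Fock K →ₗ[K] FormalFock₂ K :=
  toFormalFock₂ K ∘ₗ TensorProduct.map X Y

/-- A series of operators with values in formal combinations is formally summable if, applied to any
vector, it has in each coefficient only finitely many nonzero terms. -/
def FormallySummable {V : Type*} [AddCommMonoid V] [Module K V] {ι : Type*}
    (T : ℕ → V →ₗ[K] (ι → K)) : Prop :=
  ∀ (x : V) (i : ι), (Function.support fun s => T s x i).Finite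

/-- The coefficientwise sum of a (formally summable) series of operators. -/
def formalSum {V : Type*} [AddCommMonoid V] [Module K V] {ι : Type*}
    (T : ℕ → V →ₗ[K] (ι → K)) : V → ι → K :=
  fun x i => ∑ᶠ s, T s x i

end Basic

/-- The embedding operator `𝒢(z, z̄)` of the chiral embedding `X^A = f^A(z)`, `X̄^A = f̄^A(z̄)`,
built from the derivatives of the embedding functions. -/
def embeddingOperator {𝕂 K : Type*} [RCLike 𝕂] [RCLike K] [NormedAlgebra 𝕂 K] {n : ℕ}
    (f fbar : Fin (n + 1) → 𝕂 → K) (z zbar : 𝕂) : Fock K →ₗ[K] FormalFock K :=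
  embeddingOperatorOfCoeff (fun A s => iteratedDeriv s (f A) z)
    (fun A s => iteratedDeriv s (fbar A) zbar)

end ChiralFermion

end

/-!
The operator `𝒢` is a finite sum `∑ S, |S⟩⟨S|` over sets `S` of embedding functions, where `|S⟩` is
`embeddingKet cbar S` and `⟨S|` is `embeddingBra c S`. The kets behave like the occupation states of
a Fock space with the `n + 1` modes `A`:

* `ψ⁺_{c̄ A} |S⟩ = ± |S ∪ {A}⟩` for `A ∉ S`, and `0` for `A ∈ S`
  (`creationField_embeddingKet`);
* `ψ_s |S⟩ = ∑ A ∈ S, ± c̄ A s |S \ {A}⟩` (`formalAnnihilation_embeddingKet`).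

The pairing `⟨w, v⟩ = ∑ u, w u * v u` transposes creation operators into annihilation operators
and `|S⟩` into `⟨S|` (`embeddingBra_eq`), so the bras obey the mirrored rules with the same signs.
Matching `S` with `S \ {A}` in the double sums gives the two intertwining relations

* `𝒢 ψ⁺_s = ∑ A, c A s • ψ⁺_{c̄ A} 𝒢` (`embeddingOperatorOfCoeff_comp_creation`),
* `ψ_s 𝒢 = ∑ A, c̄ A s • 𝒢 ψ_{c A}` (`formalAnnihilation_comp_embeddingOperatorOfCoeff`).

Substituting the second into `∑ s, ψ⁺_s 𝒢 ⊗ ψ_s 𝒢` and the first into `∑ s, 𝒢 ψ⁺_s ⊗ 𝒢 ψ_s`, and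
summing over `s`, turns both series into `∑ A, ψ⁺_{c̄ A} 𝒢 ⊗ 𝒢 ψ_{c A}`.
-/

namespace ChiralFermion

open Finset

section Fields

variable {K : Type*} [CommRing K]

/-! ### Smeared creation and annihilation operators -/

lemma creationField_apply (c : ℕ → K) (w : FormalFock K) {u I : Finset ℕ} (h : u ⊆ I) :
    creationField c w u = ∑ s ∈ I, c s * formalCreation K s w u := by
  refine finsum_eq_sum_of_support_subset _ fun s hs => h ?_
  by_contra hc
  exact hs (by simp [formalCreation, hc])

lemma creationField_apply_eq_finsum (c : ℕ → K) (w : FormalFock K) (u : Finset ℕ) :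
    creationField c w u = ∑ᶠ s, c s * formalCreation K s w u := rfl

lemma annihilationField_apply (c : ℕ → K) (v : Fock K) :
    annihilationField c v = ∑ᶠ s, c s • annihilation K s v := rfl

lemma smul_annihilation_support_finite (c : ℕ → K) (v : Fock K) :
    (Function.support fun s => c s • annihilation K s v).Finite :=
  (annihilation_support_finite v).subset fun s hs h => hs (by simp [h])

lemma formalCreation_creationField (c : ℕ → K) (s : ℕ) (w : FormalFock K) :
    formalCreation K s (creationField c w) = -creationField c (formalCreation K s w) := by
  ext u
  have h (t : ℕ) : formalCreation K t (formalCreation K s w) u =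
      -formalCreation K s (formalCreation K t w) u :=
    eq_neg_of_add_eq_zero_left (congrFun (formalCreation_anticomm t s w) u)
  rw [Pi.neg_apply, creationField_apply c _ subset_rfl]
  simp only [h, mul_neg, sum_neg_distrib, neg_neg]
  by_cases hs : s ∈ u
  · simp only [formalCreation, LinearMap.coe_mk, AddHom.coe_mk, hs, if_true]
    rw [creationField_apply c w (erase_subset s u), mul_sum]
    exact sum_congr rfl fun t _ => by simp [formalCreation]; grind
  · simp [formalCreation, hs]

lemma formalAnnihilation_creationField (c : ℕ → K) (s : ℕ) (w : FormalFock K) :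
    formalAnnihilation K s (creationField c w) =
      c s • w - creationField c (formalAnnihilation K s w) := by
  ext u
  have h (t : ℕ) : formalCreation K t (formalAnnihilation K s w) u =
      (if s = t then w u else 0) - formalAnnihilation K s (formalCreation K t w) u := by
    have := congrFun (formalAnnihilation_formalCreation s t w) u
    rw [Pi.add_apply] at this
    rw [eq_sub_iff_add_eq', this]
    split_ifs <;> rfl
  rw [Pi.sub_apply, creationField_apply c _ (subset_insert s u)]
  simp only [h, mul_sub, sum_sub_distrib, mul_ite, mul_zero, sum_ite_eq, mem_insert_self, if_true,
    Pi.smul_apply, smul_eq_mul, sub_sub_cancel]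
  by_cases hs : s ∈ u
  · simp [formalAnnihilation, hs]
  · simp only [formalAnnihilation, LinearMap.coe_mk, AddHom.coe_mk, hs, if_false]
    rw [creationField_apply c w subset_rfl, mul_sum]
    exact sum_congr rfl fun t _ => by ring

lemma creationField_anticomm (c d : ℕ → K) (w : FormalFock K) :
    creationField c (creationField d w) = -creationField d (creationField c w) := by
  ext u
  simp only [Pi.neg_apply, creationField_apply _ _ (subset_refl u), formalCreation_creationField,
    mul_neg, sum_neg_distrib, mul_sum]
  rw [sum_comm]
  simp only [← sum_neg_distrib]
  refine sum_congr rfl fun s _ => sum_congr rfl fun t _ => ?_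
  rw [eq_neg_of_add_eq_zero_left (formalCreation_anticomm s t w), Pi.neg_apply]
  ring

lemma creationField_creationField_self [NoZeroDivisors K] [CharZero K] (c : ℕ → K)
    (w : FormalFock K) : creationField c (creationField c w) = 0 := by
  ext u
  have h := congrFun (creationField_anticomm c c w) u
  rw [Pi.neg_apply, eq_neg_iff_add_eq_zero] at h
  exact add_self_eq_zero.mp h

/-! ### Transposition -/

/-- `ψ⁺_s` is the transpose of `ψ_s` for the pairing `⟨w, v⟩ = ∑ u, w u * v u` of formal with finite
combinations, which is `Finsupp.linearCombination K w v`. -/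
lemma linearCombination_formalCreation (s : ℕ) (w : FormalFock K) :
    Finsupp.linearCombination K (formalCreation K s w) =
      Finsupp.linearCombination K w ∘ₗ annihilation K s := by
  ext u
  by_cases h : s ∈ u <;> simp [annihilation, formalCreation, h]

/-- `ψ_s` is the transpose of `ψ⁺_s`. -/
lemma linearCombination_formalAnnihilation (s : ℕ) (w : FormalFock K) :
    Finsupp.linearCombination K (formalAnnihilation K s w) =
      Finsupp.linearCombination K w ∘ₗ creation K s := by
  ext u
  by_cases h : s ∈ u <;> simp [creation, formalAnnihilation, h]

lemma linearCombination_creationField (c : ℕ → K) (w : FormalFock K) :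
    Finsupp.linearCombination K (creationField c w) =
      Finsupp.linearCombination K w ∘ₗ annihilationField c := by
  ext u
  simp only [LinearMap.comp_apply, Finsupp.lsingle_apply, Finsupp.linearCombination_single,
    one_smul]
  rw [annihilationField_apply, map_finsum _ (smul_annihilation_support_finite c _),
    creationField_apply_eq_finsum]
  refine finsum_congr fun s => ?_
  rw [map_smul, ← LinearMap.comp_apply, ← linearCombination_formalCreation]
  simp

lemma linearCombination_vacuumKet :
    Finsupp.linearCombination K (vacuumKet K) = vacuumBra K := by
  ext u
  simp [vacuumKet, vacuumBra, Pi.single_apply, Finsupp.single_apply]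

end Fields

/-! ### The embedding states -/

section States

variable {K : Type*} [CommRing K] {n : ℕ}

lemma linearCombination_prod_creationField (c : Fin (n + 1) → ℕ → K) (l : List (Fin (n + 1)))
    (w : FormalFock K) :
    Finsupp.linearCombination K
        (((l.map fun A => creationField (c A)).prod : Module.End K (FormalFock K)) w) =
      Finsupp.linearCombination K w ∘ₗ
        ((l.reverse.map fun A => annihilationField (c A)).prod : Module.End K (Fock K)) := by
  induction l with
  | nil => rfl
  | cons A l ih =>
    simp only [List.map_cons, List.prod_cons, Module.End.mul_apply, linearCombination_creationField,
      ih, List.reverse_cons, List.map_append, List.prod_append, List.map_nil, List.prod_nil,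
      mul_one]
    rfl

/-- The bra `⟨S|` is the pairing with the ket `|S⟩` of the same coefficient sequences. -/
lemma embeddingBra_eq (c : Fin (n + 1) → ℕ → K) (S : Finset (Fin (n + 1))) :
    embeddingBra c S = Finsupp.linearCombination K (embeddingKet c S) := by
  rw [embeddingKet, linearCombination_prod_creationField, linearCombination_vacuumKet, embeddingBra]

/-- The sign `(-1)^{#{B ∈ S : B < A}}`, the analogue of `modeSign` for embedding functions. -/
def embeddingSign (K : Type*) [CommRing K] (A : Fin (n + 1)) (S : Finset (Fin (n + 1))) : K :=
  (-1) ^ #{B ∈ S | B < A}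

lemma embeddingSign_insert_of_lt {A a : Fin (n + 1)} {S : Finset (Fin (n + 1))} (h : a < A)
    (ha : a ∉ S) : embeddingSign K A (insert a S) = -embeddingSign K A S := by
  rw [embeddingSign, filter_insert, if_pos h, card_insert_of_notMem (by simp [ha]), pow_succ,
    embeddingSign, mul_neg_one]

lemma embeddingSign_of_forall_le {A : Fin (n + 1)} {S : Finset (Fin (n + 1))}
    (h : ∀ B ∈ S, A ≤ B) : embeddingSign K A S = 1 := by
  rw [embeddingSign, filter_false_of_mem fun B hB => (h B hB).not_gt, card_empty, pow_zero]

lemma embeddingSign_insert_self (A : Fin (n + 1)) (S : Finset (Fin (n + 1))) :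
    embeddingSign K A (insert A S) = embeddingSign K A S := by
  rw [embeddingSign, filter_insert, if_neg (lt_irrefl A), embeddingSign]

lemma embeddingKet_insert (c : Fin (n + 1) → ℕ → K) {a : Fin (n + 1)} {S : Finset (Fin (n + 1))}
    (h : ∀ B ∈ S, a < B) :
    embeddingKet c (insert a S) = creationField (c a) (embeddingKet c S) := by
  have ha : a ∉ S := fun hm => lt_irrefl a (h a hm)
  rw [embeddingKet, sort_insert _ (fun B hB => (h B hB).le) ha, List.map_cons, List.prod_cons,
    Module.End.mul_apply, embeddingKet]

lemma creationField_embeddingKet [NoZeroDivisors K] [CharZero K] (c : Fin (n + 1) → ℕ → K)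
    (A : Fin (n + 1)) (S : Finset (Fin (n + 1))) :
    creationField (c A) (embeddingKet c S) =
      if A ∈ S then 0 else embeddingSign K A S • embeddingKet c (insert A S) := by
  induction S using Finset.induction_on_min with
  | empty =>
    rw [if_neg (notMem_empty A), embeddingKet_insert c (by simp),
      embeddingSign_of_forall_le (by simp), one_smul]
  | insert a S haS ih =>
    have ha : a ∉ S := fun hm => lt_irrefl a (haS a hm)
    rcases lt_trichotomy A a with h | rfl | h
    · have hA : ∀ B ∈ insert a S, A < B := by
        intro B hB
        rcases mem_insert.mp hB with rfl | hB
        exacts [h, h.trans (haS B hB)]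
      rw [if_neg fun hm => lt_irrefl A (hA A hm), embeddingKet_insert c hA,
        embeddingSign_of_forall_le fun B hB => (hA B hB).le, one_smul]
    · rw [embeddingKet_insert c haS, creationField_creationField_self, if_pos (mem_insert_self _ _)]
    · rw [embeddingKet_insert c haS, creationField_anticomm, ih]
      by_cases hA : A ∈ S
      · simp [hA]
      · have hlt : ∀ B ∈ insert A S, a < B := by
          intro B hB
          rcases mem_insert.mp hB with rfl | hB
          exacts [h, haS B hB]
        rw [if_neg hA, if_neg (by simp [hA, h.ne']), embeddingSign_insert_of_lt h ha,
          Finset.insert_comm, embeddingKet_insert c hlt, map_smul, neg_smul]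

lemma formalAnnihilation_vacuumKet (s : ℕ) : formalAnnihilation K s (vacuumKet K) = 0 := by
  ext u
  simp [formalAnnihilation, vacuumKet]

lemma formalAnnihilation_embeddingKet (c : Fin (n + 1) → ℕ → K)
    (s : ℕ) (S : Finset (Fin (n + 1))) :
    formalAnnihilation K s (embeddingKet c S) =
      ∑ A ∈ S, (embeddingSign K A S * c A s) • embeddingKet c (S.erase A) := by
  induction S using Finset.induction_on_min with
  | empty => simpa [embeddingKet] using formalAnnihilation_vacuumKet s
  | insert a S haS ih =>
    have ha : a ∉ S := fun hm => lt_irrefl a (haS a hm)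
    rw [embeddingKet_insert c haS, formalAnnihilation_creationField, ih, sum_insert ha,
      erase_insert ha, embeddingSign_insert_self,
      embeddingSign_of_forall_le fun B hB => (haS B hB).le, one_mul, map_sum, sub_eq_add_neg,
      ← sum_neg_distrib]
    refine congrArg _ (sum_congr rfl fun A hA => ?_)
    rw [embeddingSign_insert_of_lt (haS A hA) ha, erase_insert_of_ne (haS A hA).ne,
      embeddingKet_insert c fun B hB => haS B (mem_of_mem_erase hB), map_smul, neg_mul, neg_smul]

lemma embeddingBra_comp_annihilationField [NoZeroDivisors K] [CharZero K]
    (c : Fin (n + 1) → ℕ → K) (A : Fin (n + 1)) (S : Finset (Fin (n + 1))) :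
    embeddingBra c S ∘ₗ annihilationField (c A) =
      if A ∈ S then 0 else embeddingSign K A S • embeddingBra c (insert A S) := by
  rw [embeddingBra_eq, ← linearCombination_creationField, creationField_embeddingKet]
  split_ifs
  · ext; simp
  · rw [embeddingBra_eq]; ext; simp

lemma embeddingBra_comp_creation (c : Fin (n + 1) → ℕ → K) (s : ℕ) (S : Finset (Fin (n + 1))) :
    embeddingBra c S ∘ₗ creation K s =
      ∑ A ∈ S, (embeddingSign K A S * c A s) • embeddingBra c (S.erase A) := by
  simp only [embeddingBra_eq]
  rw [← linearCombination_formalAnnihilation, formalAnnihilation_embeddingKet]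
  ext
  simp

/-! ### Intertwining relations -/

lemma embeddingOperatorOfCoeff_eq_sum (c cbar : Fin (n + 1) → ℕ → K) :
    embeddingOperatorOfCoeff c cbar =
      ∑ S : Finset (Fin (n + 1)), (embeddingBra c S).smulRight (embeddingKet cbar S) := by
  rw [← powerset_univ, sum_powerset, card_univ, Fintype.card_fin, embeddingOperatorOfCoeff]

lemma embeddingOperatorOfCoeff_apply (c cbar : Fin (n + 1) → ℕ → K) (v : Fock K) :
    embeddingOperatorOfCoeff c cbar v =
      ∑ S : Finset (Fin (n + 1)), embeddingBra c S v • embeddingKet cbar S := by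
  simp [embeddingOperatorOfCoeff_eq_sum]

/-- Summing over the pairs `A ∈ S` is summing over the pairs `A ∉ T`, by `T = S \ {A}`. -/
lemma sum_sum_mem_eq_sum_sum_ite {M : Type*} [AddCommMonoid M]
    (g : Fin (n + 1) → Finset (Fin (n + 1)) → M) :
    ∑ S : Finset (Fin (n + 1)), ∑ A ∈ S, g A S =
      ∑ A, ∑ T : Finset (Fin (n + 1)), if A ∈ T then 0 else g A (insert A T) := by
  have h (S : Finset (Fin (n + 1))) : ∑ A ∈ S, g A S = ∑ A, if A ∈ S then g A S else 0 := by simp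
  simp only [h]
  rw [sum_comm]
  refine sum_congr rfl fun A _ => ?_
  have h' (T : Finset (Fin (n + 1))) : (if A ∈ T then 0 else g A (insert A T)) =
      if A ∉ T then g A (insert A T) else 0 := (ite_not ..).symm
  simp only [h']
  rw [← sum_filter, ← sum_filter]
  refine sum_bij' (fun S _ => S.erase A) (fun T _ => insert A T) ?_ ?_ ?_ ?_ ?_ <;>
    simp +contextual

variable [NoZeroDivisors K] [CharZero K]

theorem embeddingOperatorOfCoeff_comp_creation (c cbar : Fin (n + 1) → ℕ → K) (s : ℕ) :
    embeddingOperatorOfCoeff c cbar ∘ₗ creation K s =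
      ∑ A, c A s • (creationField (cbar A) ∘ₗ embeddingOperatorOfCoeff c cbar) := by
  refine LinearMap.ext fun v => ?_
  have h (S : Finset (Fin (n + 1))) : embeddingBra c S (creation K s v) =
      ∑ A ∈ S, embeddingSign K A S * c A s * embeddingBra c (S.erase A) v := by
    simpa using LinearMap.congr_fun (embeddingBra_comp_creation c s S) v
  simp only [LinearMap.comp_apply, embeddingOperatorOfCoeff_apply, h, sum_smul, LinearMap.sum_apply,
    LinearMap.smul_apply, map_sum, map_smul, creationField_embeddingKet, smul_sum]
  rw [sum_sum_mem_eq_sum_sum_ite]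
  refine sum_congr rfl fun A _ => sum_congr rfl fun T _ => ?_
  split_ifs with hA
  · simp
  · rw [erase_insert hA, embeddingSign_insert_self, smul_smul, smul_smul]
    congr 1
    ring

theorem formalAnnihilation_comp_embeddingOperatorOfCoeff (c cbar : Fin (n + 1) → ℕ → K) (s : ℕ) :
    formalAnnihilation K s ∘ₗ embeddingOperatorOfCoeff c cbar =
      ∑ A, cbar A s • (embeddingOperatorOfCoeff c cbar ∘ₗ annihilationField (c A)) := by
  refine LinearMap.ext fun v => ?_
  have h (A) (S : Finset (Fin (n + 1))) : embeddingBra c S (annihilationField (c A) v) =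
      if A ∈ S then 0 else embeddingSign K A S * embeddingBra c (insert A S) v := by
    have := LinearMap.congr_fun (embeddingBra_comp_annihilationField c A S) v
    rw [LinearMap.comp_apply] at this
    rw [this]
    split_ifs <;> simp
  simp only [LinearMap.comp_apply, embeddingOperatorOfCoeff_apply, h, LinearMap.sum_apply,
    LinearMap.smul_apply, map_sum, map_smul, formalAnnihilation_embeddingKet, smul_sum]
  rw [sum_sum_mem_eq_sum_sum_ite]
  refine sum_congr rfl fun A _ => sum_congr rfl fun T _ => ?_
  split_ifs with hA
  · simp
  · rw [erase_insert hA, embeddingSign_insert_self, smul_smul, smul_smul]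
    congr 1
    ring

end States

/-! ### The two series -/

section Series

variable {K : Type*} [CommRing K]

lemma tensorOp_tmul_apply (X Y : Fock K →ₗ[K] FormalFock K) (v v' : Fock K)
    (p : Finset ℕ × Finset ℕ) : tensorOp X Y (v ⊗ₜ v') p = X v p.1 * Y v' p.2 := by
  simp [tensorOp, toFormalFock₂]

/-- A series of operators on a tensor square can be summed on pure tensors. -/
lemma formallySummable_and_formalSum_eq_of_tmul {ι : Type*}
    {T : ℕ → Fock K ⊗[K] Fock K →ₗ[K] (ι → K)} {R : Fock K ⊗[K] Fock K →ₗ[K] (ι → K)}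
    (hT : ∀ v v' i, (Function.support fun s => T s (v ⊗ₜ v') i).Finite ∧
      ∑ᶠ s, T s (v ⊗ₜ v') i = R (v ⊗ₜ v') i) :
    FormallySummable T ∧ formalSum T = R := by
  suffices h : ∀ x i, (Function.support fun s => T s x i).Finite ∧ ∑ᶠ s, T s x i = R x i from
    ⟨fun x i => (h x i).1, funext fun x => funext fun i => (h x i).2⟩
  intro x i
  induction x using TensorProduct.induction_on with
  | zero => simp
  | tmul v v' => exact hT v v' i
  | add x y hx hy =>
    simp only [map_add, Pi.add_apply]
    exact ⟨(hx.1.union hy.1).subset (Function.support_add _ _),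
      by rw [finsum_add_distrib hx.1 hy.1, hx.2, hy.2]⟩

variable {n : ℕ} {X Y : Fin (n + 1) → Fock K →ₗ[K] FormalFock K}

/-- If `ψ_s 𝒢 = ∑ A, d A s • Y A`, then `∑ s, ψ⁺_s 𝒢 ⊗ ψ_s 𝒢 = ∑ A, ψ⁺_{d A} 𝒢 ⊗ Y A`. -/
lemma formalSum_tensorOp_creation_annihilation {G : Fock K →ₗ[K] FormalFock K}
    {d : Fin (n + 1) → ℕ → K} (h : ∀ s, formalAnnihilation K s ∘ₗ G = ∑ A, d A s • Y A) :
    FormallySummable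
        (fun s => tensorOp (formalCreation K s ∘ₗ G) (formalAnnihilation K s ∘ₗ G)) ∧
      formalSum (fun s => tensorOp (formalCreation K s ∘ₗ G) (formalAnnihilation K s ∘ₗ G)) =
        ⇑(∑ A, tensorOp (creationField (d A) ∘ₗ G) (Y A)) := by
  refine formallySummable_and_formalSum_eq_of_tmul fun v v' p => ?_
  have hsub : (Function.support fun s => formalCreation K s (G v) p.1 *
      (formalAnnihilation K s ∘ₗ G) v' p.2) ⊆ (p.1 : Set ℕ) := by
    intro s hs
    by_contra hc
    exact hs (by simp_all [formalCreation])
  simp only [tensorOp_tmul_apply, LinearMap.comp_apply (formalCreation K _)]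
  refine ⟨p.1.finite_toSet.subset hsub, ?_⟩
  rw [finsum_eq_sum_of_support_subset _ hsub]
  simp only [h, LinearMap.sum_apply, LinearMap.smul_apply, Finset.sum_apply, Pi.smul_apply,
    tensorOp_tmul_apply, LinearMap.comp_apply, creationField_apply _ _ (subset_refl p.1), sum_mul,
    mul_sum, smul_eq_mul]
  rw [sum_comm]
  exact sum_congr rfl fun A _ => sum_congr rfl fun s _ => by ring

/-- If `𝒢 ψ⁺_s = ∑ A, d A s • X A`, then `∑ s, 𝒢 ψ⁺_s ⊗ 𝒢 ψ_s = ∑ A, X A ⊗ 𝒢 ψ_{d A}`. -/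
lemma formalSum_tensorOp_comp_creation_annihilation {G : Fock K →ₗ[K] FormalFock K}
    {d : Fin (n + 1) → ℕ → K} (h : ∀ s, G ∘ₗ creation K s = ∑ A, d A s • X A) :
    FormallySummable (fun s => tensorOp (G ∘ₗ creation K s) (G ∘ₗ annihilation K s)) ∧
      formalSum (fun s => tensorOp (G ∘ₗ creation K s) (G ∘ₗ annihilation K s)) =
        ⇑(∑ A, tensorOp (X A) (G ∘ₗ annihilationField (d A))) := by
  refine formallySummable_and_formalSum_eq_of_tmul fun v v' p => ?_
  set I := (annihilation_support_finite v').toFinset with hI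
  have hann (s : ℕ) (hs : s ∉ I) : annihilation K s v' = 0 := by simpa [hI] using hs
  have hsub : (Function.support fun s => (G ∘ₗ creation K s) v p.1 *
      G (annihilation K s v') p.2) ⊆ (I : Set ℕ) := by
    intro s hs
    by_contra hc
    exact hs (by simp [hann s hc])
  have hfield (A : Fin (n + 1)) :
      annihilationField (d A) v' = ∑ s ∈ I, d A s • annihilation K s v' := by
    refine finsum_eq_sum_of_support_subset _ fun s hs => ?_
    by_contra hc
    exact hs (by simp [hann s hc])
  simp only [tensorOp_tmul_apply, LinearMap.comp_apply G (annihilation K _)]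
  refine ⟨I.finite_toSet.subset hsub, ?_⟩
  rw [finsum_eq_sum_of_support_subset _ hsub]
  simp only [h, LinearMap.sum_apply, LinearMap.smul_apply, Finset.sum_apply, Pi.smul_apply,
    tensorOp_tmul_apply, LinearMap.comp_apply, hfield, map_sum, map_smul, sum_mul, mul_sum,
    smul_eq_mul]
  rw [sum_comm]
  exact sum_congr rfl fun A _ => sum_congr rfl fun s _ => by ring

end Series

end ChiralFermion

open ChiralFermion in
theorem mainTheorem8 {𝕂 K : Type*} [RCLike 𝕂] [RCLike K] [NormedAlgebra 𝕂 K] (n : ℕ)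
    (f fbar : Fin (n + 1) → 𝕂 → K) (z zbar : 𝕂)
    (hf : ∀ A, ContDiffAt 𝕂 ∞ (f A) z) (hfbar : ∀ A, ContDiffAt 𝕂 ∞ (fbar A) zbar) :
    FormallySummable (fun s => tensorOp
        (formalCreation K s ∘ₗ embeddingOperator f fbar z zbar)
        (formalAnnihilation K s ∘ₗ embeddingOperator f fbar z zbar)) ∧
    FormallySummable (fun s => tensorOp
        (embeddingOperator f fbar z zbar ∘ₗ creation K s)
        (embeddingOperator f fbar z zbar ∘ₗ annihilation K s)) ∧
    formalSum (fun s => tensorOp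
        (formalCreation K s ∘ₗ embeddingOperator f fbar z zbar)
        (formalAnnihilation K s ∘ₗ embeddingOperator f fbar z zbar)) =
      formalSum (fun s => tensorOp
        (embeddingOperator f fbar z zbar ∘ₗ creation K s)
        (embeddingOperator f fbar z zbar ∘ₗ annihilation K s)) := by
  have hl := formalSum_tensorOp_creation_annihilation
    (formalAnnihilation_comp_embeddingOperatorOfCoeff
      (fun A s => iteratedDeriv s (f A) z) (fun A s => iteratedDeriv s (fbar A) zbar))
  have hr := formalSum_tensorOp_comp_creation_annihilation
    (embeddingOperatorOfCoeff_comp_creation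
      (fun A s => iteratedDeriv s (f A) z) (fun A s => iteratedDeriv s (fbar A) zbar))
  exact ⟨hl.1, hr.1, hl.2.trans hr.2.symm⟩
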